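/- Let $q$ be a complex number with $|q|<1$. For $a,p\in\mathbb{C}$ with $|p|<1$ write $(a;p)_n=\prod_{k=0}^{n-1}(1-ap^k)$ for $n\ge 0$, $(a;p)_\infty=\prod_{k=0}^{\infty}(1-ap^k)$, and $(a_1,a_2,a_3;p)_\infty=(a_1;p)_\infty(a_2;p)_\infty(a_3;p)_\infty$. Then the series on the left below converges absolutely, and $$\sum_{n=0}^{\infty}\frac{q^{n^2}}{(q;q)_{2n+1}}=\frac{(q^8,q^{12},q^{20};q^{20})_\infty+q\,(q^4,q^{16},q^{20};q^{20})_\infty}{(q;q)_\infty\,(-q^2;q^2)_\infty}.$$ -/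

import Mathlib

/-- The finite `q`-shifted factorial `(a;q)_n = ∏_{k=0}^{n-1} (1 - a q^k)`. -/
noncomputable def qPoch (a q : ℂ) (n : ℕ) : ℂ :=
  ∏ k ∈ Finset.range n, (1 - a * q ^ k)

/-- The infinite `q`-shifted factorial `(a;q)_∞ = ∏_{k=0}^∞ (1 - a q^k)`, used for `‖q‖ < 1`. -/
noncomputable def qPochInf (a q : ℂ) : ℂ :=
  ∏' k : ℕ, (1 - a * q ^ k)

/-- For `‖q‖ < 1` the infinite product is absolutely convergent, so `qPochInf` is its value. -/
theorem qPochInf_hasProd (a q : ℂ) (hq : ‖q‖ < 1) :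
    HasProd (fun k : ℕ => 1 - a * q ^ k) (qPochInf a q) := by
  have hs : Summable fun k : ℕ => ‖-(a * q ^ k)‖ := by
    simpa [norm_mul, norm_pow] using
      (summable_geometric_of_lt_one (norm_nonneg q) hq).mul_left ‖a‖
  have h := (multipliable_one_add_of_summable hs).hasProd
  simpa only [qPochInf, sub_eq_add_neg] using h

/-- The factors of `(a;q)_n` do not vanish when `‖a‖ < 1` and `‖q‖ < 1`. -/
theorem one_sub_mul_pow_ne_zero (a q : ℂ) (ha : ‖a‖ < 1) (hq : ‖q‖ < 1) (k : ℕ) :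
    1 - a * q ^ k ≠ 0 := by
  intro h
  have h1 : ‖a * q ^ k‖ = 1 := by rw [← sub_eq_zero.mp h, norm_one]
  rw [norm_mul, norm_pow] at h1
  have h2 : ‖q‖ ^ k ≤ 1 := pow_le_one₀ (norm_nonneg q) hq.le
  have h3 : ‖a‖ * ‖q‖ ^ k ≤ ‖a‖ * 1 := mul_le_mul_of_nonneg_left h2 (norm_nonneg a)
  linarith

theorem qPoch_ne_zero (a q : ℂ) (ha : ‖a‖ < 1) (hq : ‖q‖ < 1) (n : ℕ) : qPoch a q n ≠ 0 :=
  Finset.prod_ne_zero_iff.mpr fun k _ => one_sub_mul_pow_ne_zero a q ha hq k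

theorem qPochInf_ne_zero (a q : ℂ) (ha : ‖a‖ < 1) (hq : ‖q‖ < 1) : qPochInf a q ≠ 0 := by
  have hs : Summable fun k : ℕ => ‖-(a * q ^ k)‖ := by
    simpa [norm_mul, norm_pow] using
      (summable_geometric_of_lt_one (norm_nonneg q) hq).mul_left ‖a‖
  have h := tprod_one_add_ne_zero_of_summable (f := fun k : ℕ => -(a * q ^ k))
    (fun k => by
      simpa only [sub_eq_add_neg] using one_sub_mul_pow_ne_zero a q ha hq k) hs
  simpa only [qPochInf, sub_eq_add_neg] using h

/-!
The identity is an instance of Bailey's lemma in base `p = q²` relative to `a = p`, carried out on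
finite sums and followed by a single passage to the limit. Write `h m = 1 / (p;p)_m`, with `h m = 0`
for `m < 0` (`invPoch`); then `(1 - p^m) h m = h (m - 1)` for every integer `m`, so that all finite
sums may be taken over `ℤ` and reindexed freely.

* `bailey_pair`: `∑_r (-1)^r p^(3r²+r) h(n-2r) h(n+1+2r) = 1 / ((p;p)_n (p;p²)_{n+1})`. Lowering the
  total index `2n+1` by one at a time leaves, besides the wanted sum, only sums that are
  antisymmetric under a reflection of `r`.
* `vandermonde_sum`: a limiting `q`-Chu–Vandermonde sum, proved by telescoping, which evaluates
  `∑_j q^(j²) (-q;p)_{j+1} h(L-j) h(j-r) h(j+1+r)`.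

Since `(-q;p)_{j+1} / ((p;p)_j (p;p²)_{j+1}) = 1 / (q;q)_{2j+1}`, exchanging the two summations gives
`finite_identity`:
`∑_j q^(j²) h(L-j) / (q;q)_{2j+1}
  = (-q;p)_L ∑_r (-1)^r (q^(10r²+2r) + q q^(10r²+6r)) h(L-2r) h(L+1+2r)`.
As `L → ∞`, dominated convergence turns both sides into convergent series; the two theta series on
the right are products by `jacobi_triple_product` (itself the limit of a finite form proved in the
same way), and `qPochInf_denominator` puts the prefactor
`(-q;q²)_∞ / (q²;q²)_∞` into the stated shape.
-/

open Filter Topology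

/-! ### Reciprocal `q`-factorials with integer index -/

/-- `1 / (p;p)_m` for an integer index `m`, with the convention that it is `0` for `m < 0`. -/
noncomputable def invPoch (p : ℂ) : ℤ → ℂ
  | Int.ofNat n => (qPoch p p n)⁻¹
  | Int.negSucc _ => 0

theorem invPoch_natCast (p : ℂ) (n : ℕ) : invPoch p n = (qPoch p p n)⁻¹ := rfl

theorem invPoch_zero (p : ℂ) : invPoch p 0 = 1 := by
  simpa [qPoch] using invPoch_natCast p 0

theorem invPoch_of_neg (p : ℂ) {m : ℤ} (hm : m < 0) : invPoch p m = 0 := by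
  cases m with
  | ofNat n => exact absurd hm (by simp)
  | negSucc n => rfl

theorem qPoch_succ (a q : ℂ) (n : ℕ) : qPoch a q (n + 1) = qPoch a q n * (1 - a * q ^ n) :=
  Finset.prod_range_succ _ _

theorem norm_sq_lt_one {q : ℂ} (hq : ‖q‖ < 1) : ‖q ^ 2‖ < 1 := by
  rw [norm_pow]; exact pow_lt_one₀ (norm_nonneg q) hq two_ne_zero

theorem one_sub_pow_ne_zero {p : ℂ} (hp : ‖p‖ < 1) {n : ℕ} (hn : n ≠ 0) : 1 - p ^ n ≠ 0 := by
  obtain ⟨k, rfl⟩ := Nat.exists_eq_succ_of_ne_zero hn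
  simpa [pow_succ'] using one_sub_mul_pow_ne_zero p p hp hp k

/-- The recurrence that drives every finite identity below; at `m = 0` it reads `0 = 0`. -/
theorem one_sub_zpow_mul_invPoch {p : ℂ} (hp : ‖p‖ < 1) (m : ℤ) :
    (1 - p ^ m) * invPoch p m = invPoch p (m - 1) := by
  rcases lt_trichotomy m 0 with h | rfl | h
  · rw [invPoch_of_neg p h, invPoch_of_neg p (by omega), mul_zero]
  · rw [invPoch_of_neg p (by omega : (0 : ℤ) - 1 < 0)]; simp
  · obtain ⟨n, rfl⟩ : ∃ n : ℕ, m = (n + 1 : ℕ) := ⟨(m - 1).toNat, by omega⟩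
    have e : ((n + 1 : ℕ) : ℤ) - 1 = n := by push_cast; ring
    have h1 := one_sub_mul_pow_ne_zero p p hp hp n
    have h2 := qPoch_ne_zero p p hp hp n
    rw [e, invPoch_natCast, invPoch_natCast, qPoch_succ, zpow_natCast, pow_succ']
    field_simp

theorem tendsto_qPoch (a q : ℂ) (hq : ‖q‖ < 1) :
    Tendsto (qPoch a q) atTop (𝓝 (qPochInf a q)) :=
  (qPochInf_hasProd a q hq).tendsto_prod_nat

theorem tendsto_invPoch {p : ℂ} (hp : ‖p‖ < 1) :
    Tendsto (invPoch p) atTop (𝓝 (qPochInf p p)⁻¹) := by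
  have h1 := (tendsto_qPoch p p hp).inv₀ (qPochInf_ne_zero p p hp hp)
  have h2 : Tendsto Int.toNat atTop atTop :=
    tendsto_atTop_mono (fun m => le_rfl) (tendsto_atTop_atTop.2 fun b => ⟨b, fun a ha => by omega⟩)
  refine (h1.comp h2).congr' ?_
  filter_upwards [eventually_ge_atTop 0] with m hm
  obtain ⟨n, rfl⟩ := Int.eq_ofNat_of_zero_le hm
  rfl

theorem exists_norm_invPoch_le {p : ℂ} (hp : ‖p‖ < 1) : ∃ C, ∀ m, ‖invPoch p m‖ ≤ C := by
  have h1 := (tendsto_qPoch p p hp).inv₀ (qPochInf_ne_zero p p hp hp)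
  obtain ⟨C, hC⟩ := h1.norm.bddAbove_range
  refine ⟨C, fun m => ?_⟩
  cases m with
  | ofNat n => exact hC ⟨n, rfl⟩
  | negSucc n => simpa [invPoch] using (norm_nonneg _).trans (hC ⟨0, rfl⟩)

/-! ### Sums over the integers -/

theorem summable_of_eq_zero_of_lt_abs {f : ℤ → ℂ} (N : ℤ) (hf : ∀ r, N < |r| → f r = 0) :
    Summable f :=
  summable_of_ne_finset_zero (s := Finset.Icc (-N) N) fun r hr => hf r <| by
    by_contra h
    exact hr (Finset.mem_Icc.2 (abs_le.1 (not_lt.1 h)))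

theorem tsum_eq_zero_of_antisymm {f : ℤ → ℂ} (e : ℤ ≃ ℤ) (hf : ∀ r, f (e r) = -f r) :
    ∑' r, f r = 0 := by
  have h := e.tsum_eq f
  simp only [hf, tsum_neg] at h
  exact self_eq_neg.1 h.symm

theorem summable_pow_natAbs {x : ℝ} (h0 : 0 ≤ x) (h1 : x < 1) :
    Summable fun r : ℤ => x ^ r.natAbs := by
  have h := summable_geometric_of_lt_one h0 h1
  refine Summable.of_nat_of_neg (by simpa using h) (by simpa using h)

theorem zpow_le_pow_natAbs {x : ℝ} (h0 : 0 < x) (h1 : x < 1) {e r : ℤ} (h : |r| ≤ e) :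
    x ^ e ≤ x ^ r.natAbs := by
  rw [← zpow_natCast]
  exact zpow_le_zpow_right_of_le_one₀ h0 h1.le (by simpa using h)

theorem summable_mul_invPoch (p : ℂ) (c : ℤ → ℂ) {k : ℤ} (hk : 0 < k) (a b : ℤ) :
    Summable fun r : ℤ => c r * (invPoch p (a - k * r) * invPoch p (b + k * r)) := by
  refine summable_of_eq_zero_of_lt_abs (|a| + |b|) fun r hr => ?_
  rcases lt_abs.1 hr with h | h
  · rw [invPoch_of_neg p (m := a - k * r), zero_mul, mul_zero]
    nlinarith [le_abs_self a, abs_nonneg a, abs_nonneg b]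
  · rw [invPoch_of_neg p (m := b + k * r), mul_zero, mul_zero]
    nlinarith [le_abs_self b, abs_nonneg a, abs_nonneg b]

theorem neg_one_zpow_neg (r : ℤ) : (-1 : ℂ) ^ (-r) = (-1) ^ r := by
  rw [← inv_zpow', inv_neg_one]

theorem neg_one_zpow_add_one (r : ℤ) : (-1 : ℂ) ^ (r + 1) = -(-1) ^ r := by
  rw [zpow_add_one₀ (by norm_num)]; ring

/-! ### A Bailey pair -/

/-- Lowering the odd total index `2n+1` to `2n`: after `1 - uv = (1 - u) + u (1 - v)` is applied to
each term, the second half is antisymmetric under `r ↦ -1 - r`. -/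
theorem bailey_step_odd {p : ℂ} (h0 : p ≠ 0) (hp : ‖p‖ < 1) (n : ℤ) :
    (1 - p ^ (2 * n + 1)) * ∑' r : ℤ, (-1) ^ r * p ^ (3 * r ^ 2 + r) *
        (invPoch p (n - 2 * r) * invPoch p (n + 1 + 2 * r)) =
      ∑' r : ℤ, (-1) ^ r * p ^ (3 * r ^ 2 - r) *
        (invPoch p (n - 2 * r) * invPoch p (n + 2 * r)) := by
  let B : ℤ → ℂ := fun r => (-1) ^ r * p ^ (3 * r ^ 2 - r) *
    (invPoch p (n - 2 * r) * invPoch p (n + 2 * r))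
  let X : ℤ → ℂ := fun r => (-1) ^ r * p ^ (3 * r ^ 2 + 3 * r + n + 1) *
    (invPoch p (n - 1 - 2 * r) * invPoch p (n + 1 + 2 * r))
  have hX : ∑' r, X r = 0 := by
    refine tsum_eq_zero_of_antisymm (Equiv.subLeft (-1)) fun r => ?_
    have e1 : n - 1 - 2 * (-1 - r) = n + 1 + 2 * r := by ring
    have e2 : n + 1 + 2 * (-1 - r) = n - 1 - 2 * r := by ring
    have e3 : 3 * (-1 - r) ^ 2 + 3 * (-1 - r) + n + 1 = 3 * r ^ 2 + 3 * r + n + 1 := by ring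
    have e4 : (-1 : ℂ) ^ (-1 - r) = -(-1) ^ r := by
      rw [← neg_one_zpow_add_one, ← neg_one_zpow_neg]; congr 1; ring
    simp only [X, Equiv.subLeft_apply, e1, e2, e3, e4]
    ring
  have key : ∀ r : ℤ, (1 - p ^ (2 * n + 1)) * ((-1) ^ r * p ^ (3 * r ^ 2 + r) *
      (invPoch p (n - 2 * r) * invPoch p (n + 1 + 2 * r))) = B (-r) + X r := fun r => by
    have h1 := one_sub_zpow_mul_invPoch hp (n + 1 + 2 * r)
    have h2 := one_sub_zpow_mul_invPoch hp (n - 2 * r)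
    rw [show n + 1 + 2 * r - 1 = n + 2 * r by ring] at h1
    rw [show n - 2 * r - 1 = n - 1 - 2 * r by ring] at h2
    have e3 : n - 2 * -r = n + 2 * r := by ring
    have e4 : n + 2 * -r = n - 2 * r := by ring
    have e5 : 3 * (-r) ^ 2 - -r = 3 * r ^ 2 + r := by ring
    have e7 : p ^ (3 * r ^ 2 + 3 * r + n + 1) = p ^ (3 * r ^ 2 + r) * p ^ (n + 1 + 2 * r) := by
      rw [← zpow_add₀ h0]; ring_nf
    have e8 : p ^ (2 * n + 1) = p ^ (n + 1 + 2 * r) * p ^ (n - 2 * r) := by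
      rw [← zpow_add₀ h0]; ring_nf
    simp only [B, X, e3, e4, e5, neg_one_zpow_neg, e7, e8, ← h1, ← h2]
    ring
  have sB : Summable B := summable_mul_invPoch p _ two_pos _ _
  have sB' : Summable fun r => B (-r) := (Equiv.neg ℤ).summable_iff.2 sB
  have sX : Summable X := summable_mul_invPoch p _ two_pos _ _
  rw [← tsum_mul_left, tsum_congr key, sB'.tsum_add sX, hX, add_zero]
  exact (Equiv.neg ℤ).tsum_eq B

/-- Lowering the even total index `2n+2` to `2n+1`: once one half of the split terms is reflected by
`r ↦ -r`, the discrepancy `Z` is antisymmetric under the same reflection. -/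
theorem bailey_step_even {p : ℂ} (h0 : p ≠ 0) (hp : ‖p‖ < 1) (n : ℤ) :
    (1 - p ^ (2 * n + 2)) * ∑' r : ℤ, (-1) ^ r * p ^ (3 * r ^ 2 - r) *
        (invPoch p (n + 1 - 2 * r) * invPoch p (n + 1 + 2 * r)) =
      (1 + p ^ (n + 1)) * ∑' r : ℤ, (-1) ^ r * p ^ (3 * r ^ 2 + r) *
        (invPoch p (n - 2 * r) * invPoch p (n + 1 + 2 * r)) := by
  let A : ℤ → ℂ := fun r => (-1) ^ r * p ^ (3 * r ^ 2 + r) *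
    (invPoch p (n - 2 * r) * invPoch p (n + 1 + 2 * r))
  let X : ℤ → ℂ := fun r => (-1) ^ r * p ^ (3 * r ^ 2 - r) *
    (invPoch p (n - 2 * r) * invPoch p (n + 1 + 2 * r))
  let Y : ℤ → ℂ := fun r => (-1) ^ r * p ^ (3 * r ^ 2 - 3 * r + n + 1) *
    (invPoch p (n + 1 - 2 * r) * invPoch p (n + 2 * r))
  let Z : ℤ → ℂ := fun r => (-1) ^ r * (p ^ (3 * r ^ 2 - r) - p ^ (3 * r ^ 2 + r)) *
    (invPoch p (n - 2 * r) * invPoch p (n + 2 * r))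
  have hZ : ∑' r, Z r = 0 := by
    refine tsum_eq_zero_of_antisymm (Equiv.neg ℤ) fun r => ?_
    have e1 : n - 2 * -r = n + 2 * r := by ring
    have e2 : n + 2 * -r = n - 2 * r := by ring
    have e3 : 3 * (-r) ^ 2 - -r = 3 * r ^ 2 + r := by ring
    have e4 : 3 * (-r) ^ 2 + -r = 3 * r ^ 2 - r := by ring
    simp only [Z, Equiv.neg_apply, e1, e2, e3, e4, neg_one_zpow_neg]
    ring
  have key : ∀ r : ℤ, (1 - p ^ (2 * n + 2)) * ((-1) ^ r * p ^ (3 * r ^ 2 - r) *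
      (invPoch p (n + 1 - 2 * r) * invPoch p (n + 1 + 2 * r))) = X r + Y r := fun r => by
    have h1 := one_sub_zpow_mul_invPoch hp (n + 1 + 2 * r)
    have h2 := one_sub_zpow_mul_invPoch hp (n + 1 - 2 * r)
    rw [show n + 1 + 2 * r - 1 = n + 2 * r by ring] at h1
    rw [show n + 1 - 2 * r - 1 = n - 2 * r by ring] at h2
    have e7 : p ^ (3 * r ^ 2 - 3 * r + n + 1) = p ^ (3 * r ^ 2 - r) * p ^ (n + 1 - 2 * r) := by
      rw [← zpow_add₀ h0]; ring_nf
    have e8 : p ^ (2 * n + 2) = p ^ (n + 1 + 2 * r) * p ^ (n + 1 - 2 * r) := by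
      rw [← zpow_add₀ h0]; ring_nf
    simp only [X, Y, e7, e8, ← h1, ← h2]
    ring
  have key' : ∀ r : ℤ, X r + Y (-r) = (1 + p ^ (n + 1)) * A r + Z r := fun r => by
    have h1 := one_sub_zpow_mul_invPoch hp (n + 1 + 2 * r)
    rw [show n + 1 + 2 * r - 1 = n + 2 * r by ring] at h1
    have e1 : n + 1 - 2 * -r = n + 1 + 2 * r := by ring
    have e2 : n + 2 * -r = n - 2 * r := by ring
    have e3 : p ^ (3 * r ^ 2 + r) = p ^ (3 * r ^ 2 - r) * (p ^ r) ^ 2 := by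
      rw [← zpow_natCast, ← zpow_mul, ← zpow_add₀ h0]; push_cast; ring_nf
    have e4 : p ^ (n + 1 + 2 * r) = p ^ (n + 1) * (p ^ r) ^ 2 := by
      rw [← zpow_natCast, ← zpow_mul, ← zpow_add₀ h0]; push_cast; ring_nf
    have e5 : p ^ (3 * (-r) ^ 2 - 3 * -r + n + 1) =
        p ^ (3 * r ^ 2 - r) * p ^ (n + 1) * (p ^ r) ^ 4 := by
      rw [← zpow_natCast, ← zpow_mul, ← zpow_add₀ h0, ← zpow_add₀ h0]; push_cast; ring_nf
    rw [e4] at h1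
    simp only [A, X, Y, Z, e1, e2, e3, e5, neg_one_zpow_neg, ← h1]
    ring
  have sA : Summable A := summable_mul_invPoch p _ two_pos _ _
  have sX : Summable X := summable_mul_invPoch p _ two_pos _ _
  have sY : Summable Y := summable_mul_invPoch p _ two_pos _ _
  have sY' : Summable fun r => Y (-r) := (Equiv.neg ℤ).summable_iff.2 sY
  have sZ : Summable Z := summable_mul_invPoch p _ two_pos _ _
  rw [← tsum_mul_left, tsum_congr key, sX.tsum_add sY, ← (Equiv.neg ℤ).tsum_eq Y]
  simp only [Equiv.neg_apply]
  rw [← sX.tsum_add sY', tsum_congr key', (sA.mul_left _).tsum_add sZ, hZ, add_zero, tsum_mul_left]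

/-- The Bailey pair relative to `a = p` with `β_n = 1 / ((p;p)_n (p;p²)_{n+1})`, with the defining
sum folded out to one over all integers. -/
theorem bailey_pair {p : ℂ} (h0 : p ≠ 0) (hp : ‖p‖ < 1) (n : ℕ) :
    ∑' r : ℤ, (-1) ^ r * p ^ (3 * r ^ 2 + r) *
        (invPoch p (n - 2 * r) * invPoch p (n + 1 + 2 * r)) =
      (qPoch p p n * qPoch p (p ^ 2) (n + 1))⁻¹ := by
  have hp2 := norm_sq_lt_one hp
  induction n with
  | zero =>
    rw [tsum_eq_single 0]
    · have := invPoch_natCast p 1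
      simp only [Nat.cast_one] at this
      simp [invPoch_zero, this, qPoch]
    · intro r hr
      rcases lt_or_gt_of_ne hr with h | h
      · rw [invPoch_of_neg p (m := _ + 1 + 2 * r) (by push_cast; omega), mul_zero, mul_zero]
      · rw [invPoch_of_neg p (m := _ - 2 * r) (by push_cast; omega), zero_mul, mul_zero]
  | succ n ih =>
    have h1 := bailey_step_odd h0 hp (n + 1)
    have h2 := bailey_step_even h0 hp n
    rw [ih] at h2
    have n1 : (1 : ℂ) - p ^ (n + 1) ≠ 0 := one_sub_pow_ne_zero hp (by omega)
    have n2 : (1 : ℂ) - p * (p ^ 2) ^ (n + 1) ≠ 0 := one_sub_mul_pow_ne_zero _ _ hp hp2 _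
    have n3 : (1 : ℂ) - p ^ (2 * n + 2) ≠ 0 := one_sub_pow_ne_zero hp (by omega)
    have n4 := qPoch_ne_zero p p hp hp n
    have n5 := qPoch_ne_zero p (p ^ 2) hp hp2 (n + 1)
    have e1 : p ^ (2 * (n : ℤ) + 2) = p ^ (2 * n + 2) := by exact_mod_cast zpow_natCast p _
    have e2 : p ^ ((n : ℤ) + 1) = p ^ (n + 1) := by exact_mod_cast zpow_natCast p _
    have e3 : p ^ (2 * ((n : ℤ) + 1) + 1) = p * (p ^ 2) ^ (n + 1) := by
      rw [← pow_mul, ← pow_succ']; exact_mod_cast zpow_natCast p _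
    rw [e1, e2] at h2
    rw [e3] at h1
    rw [qPoch_succ, qPoch_succ p (p ^ 2) (n + 1), ← pow_succ']
    push_cast
    refine mul_left_cancel₀ n3 (mul_left_cancel₀ n2 ?_)
    rw [mul_left_comm, h1, h2]
    field_simp
    ring

/-! ### A finite `q`-Chu–Vandermonde sum -/

theorem one_sub_zpow_ne_zero {p : ℂ} (hp : ‖p‖ < 1) {m : ℤ} (hm : m ≠ 0) : 1 - p ^ m ≠ 0 := by
  intro h
  have h1 : ‖p‖ ^ m = 1 := by rw [← norm_zpow, ← sub_eq_zero.1 h, norm_one]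
  exact hm ((zpow_eq_one_iff_right₀ (norm_nonneg p) hp.ne).1 h1)

/-- Telescoping in `j` gives the first-order recurrence in `L` of the `q`-Chu–Vandermonde sum. -/
theorem vandermonde_recurrence {q : ℂ} (h0 : q ≠ 0) (hq : ‖q‖ < 1) (L : ℕ) (r : ℤ) :
    (1 - (q ^ 2) ^ (L + 1 - r)) * (1 - (q ^ 2) ^ (L + 2 + r)) *
      ∑ j ∈ Finset.range (L + 2), q ^ (j ^ 2) * qPoch (-q) (q ^ 2) (j + 1) *
        (invPoch (q ^ 2) (L + 1 - j) * (invPoch (q ^ 2) (j - r) * invPoch (q ^ 2) (j + 1 + r))) =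
    (1 + q ^ (2 * L + 1)) *
      ∑ j ∈ Finset.range (L + 1), q ^ (j ^ 2) * qPoch (-q) (q ^ 2) (j + 1) *
        (invPoch (q ^ 2) (L - j) * (invPoch (q ^ 2) (j - r) * invPoch (q ^ 2) (j + 1 + r))) := by
  have hp := norm_sq_lt_one hq
  have hp0 : q ^ 2 ≠ 0 := pow_ne_zero 2 h0
  -- `G` is the telescoping certificate for the difference of the two summands.
  let G : ℕ → ℂ := fun j => -(q ^ 2) ^ ((L : ℤ) + 1 - j) * q ^ (j ^ 2) *
    qPoch (-q) (q ^ 2) (j + 1) * (invPoch (q ^ 2) (L + 1 - j) *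
      (invPoch (q ^ 2) (j - 1 - r) * invPoch (q ^ 2) (j + r)))
  have hG0 : G 0 = 0 := by
    rcases lt_or_ge r 0 with h | h
    · simp only [G]
      rw [invPoch_of_neg _ (m := _ + r) (by push_cast; omega), mul_zero, mul_zero, mul_zero]
    · simp only [G]
      rw [invPoch_of_neg _ (m := _ - 1 - r) (by push_cast; omega), zero_mul, mul_zero, mul_zero]
  have hGL : G (L + 2) = 0 := by
    simp only [G]
    rw [invPoch_of_neg _ (m := _ + 1 - _) (by push_cast; omega), zero_mul, mul_zero]
  have key : ∀ j : ℕ, (1 - (q ^ 2) ^ (L + 1 - r)) * (1 - (q ^ 2) ^ (L + 2 + r)) *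
      (q ^ (j ^ 2) * qPoch (-q) (q ^ 2) (j + 1) *
        (invPoch (q ^ 2) (L + 1 - j) * (invPoch (q ^ 2) (j - r) * invPoch (q ^ 2) (j + 1 + r)))) -
      (1 + q ^ (2 * L + 1)) * (q ^ (j ^ 2) * qPoch (-q) (q ^ 2) (j + 1) *
        (invPoch (q ^ 2) (L - j) * (invPoch (q ^ 2) (j - r) * invPoch (q ^ 2) (j + 1 + r)))) =
      G (j + 1) - G j := fun j => by
    have h1 := one_sub_zpow_mul_invPoch hp (L + 1 - j)
    have h2 := one_sub_zpow_mul_invPoch hp (j - r)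
    have h3 := one_sub_zpow_mul_invPoch hp (j + 1 + r)
    rw [show (L : ℤ) + 1 - j - 1 = L - j by ring] at h1
    rw [show (j : ℤ) - r - 1 = j - 1 - r by ring] at h2
    rw [show (j : ℤ) + 1 + r - 1 = j + r by ring] at h3
    have e1 : (L : ℤ) + 1 - (j + 1 : ℕ) = L - j := by push_cast; ring
    have e2 : ((j + 1 : ℕ) : ℤ) - 1 - r = j - r := by push_cast; ring
    have e3 : ((j + 1 : ℕ) : ℤ) + r = j + 1 + r := by push_cast; ring
    have f1 : (q ^ 2) ^ ((L : ℤ) + 1 - j) = q ^ 2 * (q ^ 2) ^ ((L : ℤ) - j) := by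
      rw [← zpow_one_add₀ hp0]; ring_nf
    have f2 : (q ^ 2) ^ ((L : ℤ) + 1 - r) =
        q ^ 2 * (q ^ 2) ^ ((L : ℤ) - j) * (q ^ 2) ^ ((j : ℤ) - r) := by
      rw [← zpow_one_add₀ hp0, ← zpow_add₀ hp0]; ring_nf
    have f3 : (q ^ 2) ^ ((L : ℤ) + 2 + r) =
        q ^ 2 * (q ^ 2) ^ ((L : ℤ) - j) * (q ^ 2) ^ ((j : ℤ) + 1 + r) := by
      rw [← zpow_one_add₀ hp0, ← zpow_add₀ hp0]; ring_nf
    have f4 : q ^ (2 * L + 1) = q * (q ^ j) ^ 2 * (q ^ 2) ^ ((L : ℤ) - j) := by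
      rw [zpow_sub₀ hp0, zpow_natCast, zpow_natCast, ← pow_mul q 2 j, pow_right_comm q j 2,
        ← pow_mul q 2 j]
      field_simp
      ring
    have f5 : (q ^ 2) ^ ((j : ℤ) - r) * (q ^ 2) ^ ((j : ℤ) + 1 + r) = q ^ 2 * (q ^ j) ^ 4 := by
      rw [← zpow_add₀ hp0, show (j : ℤ) - r + (j + 1 + r) = ((2 * j + 1 : ℕ) : ℤ) by push_cast; ring,
        zpow_natCast]
      ring
    have f6 : q ^ ((j + 1) ^ 2) = q ^ (j ^ 2) * (q ^ j) ^ 2 * q := by ring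
    have f7 : (q ^ 2) ^ (j + 1) = q ^ 2 * (q ^ j) ^ 2 := by ring
    simp only [G, e1, e2, e3, qPoch_succ _ _ (j + 1), ← h1, ← h2, ← h3, f1, f2, f3, f4, f6, f7]
    generalize (q ^ 2) ^ ((L : ℤ) - j) = D, (q ^ 2) ^ ((j : ℤ) - r) = u,
      (q ^ 2) ^ ((j : ℤ) + 1 + r) = v, q ^ j = x at *
    linear_combination (q ^ (j ^ 2) * qPoch (-q) (q ^ 2) (j + 1) * invPoch (q ^ 2) (L + 1 - j) *
      invPoch (q ^ 2) (j - r) * invPoch (q ^ 2) (j + 1 + r)) * (q ^ 4 * D ^ 2 - q ^ 2 * D) * f5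
  have hlast : ∀ f : ℕ → ℂ, ∑ j ∈ Finset.range (L + 1), f j * (invPoch (q ^ 2) (L - j) *
      (invPoch (q ^ 2) (j - r) * invPoch (q ^ 2) (j + 1 + r))) =
      ∑ j ∈ Finset.range (L + 2), f j * (invPoch (q ^ 2) (L - j) *
      (invPoch (q ^ 2) (j - r) * invPoch (q ^ 2) (j + 1 + r))) := fun f => by
    rw [Finset.sum_range_succ _ (L + 1), invPoch_of_neg _ (m := (L : ℤ) - _) (by push_cast; omega)]
    simp
  rw [hlast, ← sub_eq_zero, Finset.mul_sum, Finset.mul_sum, ← Finset.sum_sub_distrib,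
    Finset.sum_congr rfl fun j _ => key j, Finset.sum_range_sub, hGL, hG0, sub_zero]

/-- The limiting `q`-Chu–Vandermonde sum that carries a Bailey pair relative to `a = q²` in base `q²`
to a new one, with parameters `ρ₁ = -q³` and `ρ₂ → ∞`. The sum of two powers on the right, which
comes from `(-q³;q²)_r / (-q;q²)_r`, is the source of the two theta functions. -/
theorem vandermonde_sum {q : ℂ} (h0 : q ≠ 0) (hq : ‖q‖ < 1) (L : ℕ) (r : ℤ) :
    ∑ j ∈ Finset.range (L + 1), q ^ (j ^ 2) * qPoch (-q) (q ^ 2) (j + 1) *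
        (invPoch (q ^ 2) (L - j) * (invPoch (q ^ 2) (j - r) * invPoch (q ^ 2) (j + 1 + r))) =
      qPoch (-q) (q ^ 2) L * (q ^ (r ^ 2) + q ^ ((r + 1) ^ 2)) *
        (invPoch (q ^ 2) (L - r) * invPoch (q ^ 2) (L + 1 + r)) := by
  have hp := norm_sq_lt_one hq
  -- At `r = L` and `r = -1 - L` the recurrence degenerates, but only the term `j = L` survives.
  have hend : ∀ (L : ℕ) (r : ℤ), r = L ∨ r = -1 - L →
      ∑ j ∈ Finset.range (L + 1), q ^ (j ^ 2) * qPoch (-q) (q ^ 2) (j + 1) *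
        (invPoch (q ^ 2) (L - j) * (invPoch (q ^ 2) (j - r) * invPoch (q ^ 2) (j + 1 + r))) =
      qPoch (-q) (q ^ 2) L * (q ^ (r ^ 2) + q ^ ((r + 1) ^ 2)) *
        (invPoch (q ^ 2) (L - r) * invPoch (q ^ 2) (L + 1 + r)) := by
    intro L r hr
    rw [Finset.sum_range_succ, Finset.sum_eq_zero, zero_add, sub_self, invPoch_zero, one_mul,
      qPoch_succ]
    · have e1 : q ^ ((L : ℤ) ^ 2) = q ^ (L ^ 2) := by exact_mod_cast zpow_natCast q _
      have e2 : q ^ (((L : ℤ) + 1) ^ 2) = q ^ (L ^ 2) * (q * (q ^ 2) ^ L) := by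
        rw [show ((L : ℤ) + 1) ^ 2 = (((L + 1) ^ 2 : ℕ) : ℤ) by push_cast; ring, zpow_natCast]
        ring
      have e3 : q ^ (r ^ 2) + q ^ ((r + 1) ^ 2) = q ^ (L ^ 2) + q ^ (L ^ 2) * (q * (q ^ 2) ^ L) := by
        rcases hr with rfl | rfl
        · rw [e1, e2]
        · rw [← e2, ← e1, add_comm]; ring_nf
      rw [e3]
      ring
    · intro j hj
      rw [Finset.mem_range] at hj
      rcases hr with rfl | rfl
      · rw [invPoch_of_neg _ (m := (j : ℤ) - L) (by omega)]; simp
      · rw [invPoch_of_neg _ (m := (j : ℤ) + 1 + (-1 - L)) (by omega)]; simp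
  induction L with
  | zero =>
    by_cases hr : r = 0 ∨ r = -1
    · exact hend 0 r (by simpa using hr)
    · have : invPoch (q ^ 2) (0 - r) * invPoch (q ^ 2) (0 + 1 + r) = 0 := by
        rcases lt_or_ge 0 r with h | h
        · rw [invPoch_of_neg _ (by omega), zero_mul]
        · rw [invPoch_of_neg _ (m := _ + 1 + r) (by omega), mul_zero]
      rw [Finset.sum_range_one, Nat.cast_zero, this, mul_zero, mul_zero, mul_zero]
  | succ L ih =>
    by_cases hr : r = (L + 1 : ℕ) ∨ r = -1 - (L + 1 : ℕ)
    · exact hend _ r hr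
    · push_cast at hr
      have n1 : 1 - (q ^ 2) ^ ((L : ℤ) + 1 - r) ≠ 0 := one_sub_zpow_ne_zero hp (by omega)
      have n2 : 1 - (q ^ 2) ^ ((L : ℤ) + 2 + r) ≠ 0 := one_sub_zpow_ne_zero hp (by omega)
      have h := vandermonde_recurrence h0 hq L r
      have h1 := one_sub_zpow_mul_invPoch hp (L + 1 - r)
      have h2 := one_sub_zpow_mul_invPoch hp (L + 2 + r)
      rw [show (L : ℤ) + 1 - r - 1 = L - r by ring] at h1
      rw [show (L : ℤ) + 2 + r - 1 = L + 1 + r by ring] at h2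
      rw [ih, ← h1, ← h2] at h
      push_cast
      rw [show (L : ℤ) + 1 + 1 + r = L + 2 + r by ring]
      refine mul_left_cancel₀ (mul_ne_zero n1 n2) (h.trans ?_)
      rw [qPoch_succ]
      ring

/-! ### The Jacobi triple product -/

/-- Finite Jacobi triple product. The theta coefficients `w r = (-z)^r P^{r(r-1)/2}` enter only
through their recurrence. -/
theorem finite_triple_product {P z : ℂ} (h0 : P ≠ 0) (hP : ‖P‖ < 1) (hz : z ≠ 0) {w : ℤ → ℂ}
    (w0 : w 0 = 1) (hw : ∀ r, w (r + 1) = -z * P ^ r * w r) (M : ℕ) :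
    ∑' r : ℤ, w r * (invPoch P (M - r) * invPoch P (M + r)) =
      qPoch z P M * qPoch (P / z) P M * (qPoch P P (2 * M))⁻¹ := by
  have hs : ∀ (c : ℤ → ℂ) (a b : ℤ),
      Summable fun r => c r * (invPoch P (a - r) * invPoch P (b + r)) := fun c a b => by
    simpa using summable_mul_invPoch P c one_pos a b
  induction M with
  | zero =>
    rw [tsum_eq_single 0]
    · simp [invPoch_zero, w0, qPoch]
    · intro r hr
      rcases lt_or_gt_of_ne hr with h | h
      · rw [invPoch_of_neg P (m := _ + r) (by push_cast; omega), mul_zero, mul_zero]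
      · rw [invPoch_of_neg P (m := _ - r) (by push_cast; omega), zero_mul, mul_zero]
  | succ M ih =>
    -- `V` interpolates between the sums for `M` and `M + 1`; each half-step splits a factor
    -- `1 - uv` as `(1 - u) + u (1 - v)` and shifts one half by `1`.
    let U : ℤ → ℂ := fun r => w r * (invPoch P (M - r) * invPoch P (M + r))
    let V : ℤ → ℂ := fun r => w r * (invPoch P (M - r) * invPoch P (M + 1 + r))
    have sU : Summable U := hs _ _ _
    have sV : Summable V := hs _ _ _
    have hV : (1 - P ^ (2 * (M : ℤ) + 1)) * ∑' r, V r = (1 - P ^ ((M : ℤ) + 1) / z) * ∑' r, U r := by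
      have key : ∀ r, (1 - P ^ (2 * (M : ℤ) + 1)) * V r =
          U r + -(P ^ ((M : ℤ) + 1) / z) * U (r + 1) := fun r => by
        have h1 := one_sub_zpow_mul_invPoch hP (M + 1 + r)
        have h2 := one_sub_zpow_mul_invPoch hP (M - r)
        rw [show (M : ℤ) + 1 + r - 1 = M + r by ring] at h1
        rw [show (M : ℤ) - r - 1 = M - (r + 1) by ring] at h2
        have e1 : P ^ (2 * (M : ℤ) + 1) = P ^ ((M : ℤ) + 1) * P ^ r * P ^ ((M : ℤ) - r) := by
          rw [← zpow_add₀ h0, ← zpow_add₀ h0]; ring_nf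
        have e2 : (M : ℤ) + (r + 1) = M + 1 + r := by ring
        have e3 : P ^ ((M : ℤ) + 1 + r) = P ^ ((M : ℤ) + 1) * P ^ r := zpow_add₀ h0 _ _
        rw [e3] at h1
        simp only [U, V, hw, e1, e2, ← h1, ← h2]
        field_simp
        ring
      have sU' : Summable fun r => U (r + 1) := (Equiv.addRight (1 : ℤ)).summable_iff.2 sU
      have hshift : ∑' r, U (r + 1) = ∑' r, U r := (Equiv.addRight (1 : ℤ)).tsum_eq U
      rw [← tsum_mul_left, tsum_congr key, sU.tsum_add (sU'.mul_left _), tsum_mul_left, hshift]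
      ring
    have hU : (1 - P ^ (2 * (M : ℤ) + 2)) *
        ∑' r, w r * (invPoch P (M + 1 - r) * invPoch P (M + 1 + r)) =
        (1 - z * P ^ (M : ℤ)) * ∑' r, V r := by
      let Y : ℤ → ℂ := fun r => w r * P ^ ((M : ℤ) + 1 - r) *
        (invPoch P (M + 1 - r) * invPoch P (M + r))
      have sY : Summable Y := hs _ _ _
      have hY : ∑' r, Y r = -z * P ^ (M : ℤ) * ∑' r, V r := by
        rw [← (Equiv.addRight (1 : ℤ)).tsum_eq Y, ← tsum_mul_left]
        refine tsum_congr fun r => ?_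
        have e1 : (M : ℤ) + 1 - (r + 1) = M - r := by ring
        have e2 : (M : ℤ) + (r + 1) = M + 1 + r := by ring
        have e3 : P ^ (M : ℤ) = P ^ r * P ^ ((M : ℤ) - r) := by
          rw [← zpow_add₀ h0]; ring_nf
        simp only [Y, V, Equiv.coe_addRight, hw, e1, e2, e3]
        ring
      have key : ∀ r, (1 - P ^ (2 * (M : ℤ) + 2)) *
          (w r * (invPoch P (M + 1 - r) * invPoch P (M + 1 + r))) = V r + Y r := fun r => by
        have h1 := one_sub_zpow_mul_invPoch hP (M + 1 + r)
        have h2 := one_sub_zpow_mul_invPoch hP (M + 1 - r)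
        rw [show (M : ℤ) + 1 + r - 1 = M + r by ring] at h1
        rw [show (M : ℤ) + 1 - r - 1 = M - r by ring] at h2
        have e1 : P ^ (2 * (M : ℤ) + 2) = P ^ ((M : ℤ) + 1 + r) * P ^ ((M : ℤ) + 1 - r) := by
          rw [← zpow_add₀ h0]; ring_nf
        simp only [V, Y, e1, ← h1, ← h2]
        ring
      rw [← tsum_mul_left, tsum_congr key, sV.tsum_add sY, hY]
      ring
    have e1 : P ^ (2 * (M : ℤ) + 2) = P ^ (2 * M + 2) := by exact_mod_cast zpow_natCast P _
    have e2 : P ^ (2 * (M : ℤ) + 1) = P ^ (2 * M + 1) := by exact_mod_cast zpow_natCast P _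
    have e3 : P ^ ((M : ℤ) + 1) = P ^ (M + 1) := by exact_mod_cast zpow_natCast P _
    have n1 : (1 : ℂ) - P ^ (2 * M + 1) ≠ 0 := one_sub_pow_ne_zero hP (by omega)
    have n2 : (1 : ℂ) - P ^ (2 * M + 2) ≠ 0 := one_sub_pow_ne_zero hP (by omega)
    have n3 := qPoch_ne_zero P P hP hP (2 * M)
    rw [show ∑' r, U r = _ from ih, e2, e3] at hV
    rw [e1, zpow_natCast] at hU
    push_cast
    refine mul_left_cancel₀ n2 (mul_left_cancel₀ n1 ?_)
    rw [hU, mul_left_comm, hV, show 2 * (M + 1) = 2 * M + 1 + 1 by ring, qPoch_succ, qPoch_succ,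
      qPoch_succ, qPoch_succ, ← pow_succ', ← pow_succ']
    field_simp
    ring

theorem tendsto_tsum_mul_invPoch {p : ℂ} (hp : ‖p‖ < 1) {w : ℤ → ℂ} (hw : Summable fun r => ‖w r‖)
    (k a : ℤ) :
    Tendsto (fun M : ℕ => ∑' r, w r * (invPoch p (M - k * r) * invPoch p (M + a + k * r))) atTop
      (𝓝 ((∑' r, w r) * ((qPochInf p p)⁻¹ * (qPochInf p p)⁻¹))) := by
  obtain ⟨C, hC⟩ := exists_norm_invPoch_le hp
  have hC0 : 0 ≤ C := (norm_nonneg _).trans (hC 0)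
  rw [← tsum_mul_right]
  refine tendsto_tsum_of_dominated_convergence (hw.mul_right (C * C)) (fun r => ?_)
    (Eventually.of_forall fun M r => ?_)
  · refine tendsto_const_nhds.mul (Tendsto.mul ?_ ?_)
    · refine (tendsto_invPoch hp).comp ?_
      simpa [sub_eq_add_neg] using
        tendsto_atTop_add_const_right atTop (-(k * r)) tendsto_natCast_atTop_atTop
    · refine (tendsto_invPoch hp).comp ?_
      simpa [add_assoc] using
        tendsto_atTop_add_const_right atTop (a + k * r) tendsto_natCast_atTop_atTop
  · rw [norm_mul, norm_mul]
    exact mul_le_mul_of_nonneg_left (mul_le_mul (hC _) (hC _) (norm_nonneg _) hC0) (norm_nonneg _)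

theorem jacobi_triple_product {P z : ℂ} (h0 : P ≠ 0) (hP : ‖P‖ < 1) (hz : z ≠ 0) {w : ℤ → ℂ}
    (w0 : w 0 = 1) (hw : ∀ r, w (r + 1) = -z * P ^ r * w r) (hs : Summable fun r => ‖w r‖) :
    ∑' r, w r = qPochInf z P * qPochInf (P / z) P * qPochInf P P := by
  have h1 := tendsto_tsum_mul_invPoch hP hs 1 0
  simp only [one_mul, add_zero, finite_triple_product h0 hP hz w0 hw] at h1
  have h2 : Tendsto (fun M : ℕ => 2 * M) atTop atTop :=
    tendsto_id.const_mul_atTop' two_pos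
  have n := qPochInf_ne_zero P P hP hP
  have h3 := tendsto_nhds_unique h1 (((tendsto_qPoch z P hP).mul (tendsto_qPoch (P / z) P hP)).mul
    (((tendsto_qPoch P P hP).comp h2).inv₀ n))
  field_simp at h3
  rw [h3]
  ring

/-! ### Infinite product identities -/

theorem qPoch_mul_qPoch_neg (a q : ℂ) (n : ℕ) :
    qPoch a q n * qPoch (-a) q n = qPoch (a ^ 2) (q ^ 2) n := by
  rw [qPoch, qPoch, qPoch, ← Finset.prod_mul_distrib]
  exact Finset.prod_congr rfl fun k _ => by ring

theorem qPoch_two_mul (a q : ℂ) (n : ℕ) :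
    qPoch a q (2 * n) = qPoch a (q ^ 2) n * qPoch (a * q) (q ^ 2) n := by
  induction n with
  | zero => simp [qPoch]
  | succ n ih =>
    rw [show 2 * (n + 1) = 2 * n + 1 + 1 by ring]
    simp only [qPoch_succ, ih]
    ring

theorem qPochInf_mul_qPochInf_neg (a q : ℂ) (hq : ‖q‖ < 1) :
    qPochInf a q * qPochInf (-a) q = qPochInf (a ^ 2) (q ^ 2) := by
  have h := (tendsto_qPoch a q hq).mul (tendsto_qPoch (-a) q hq)
  simp only [qPoch_mul_qPoch_neg] at h
  exact tendsto_nhds_unique h (tendsto_qPoch _ _ (norm_sq_lt_one hq))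

theorem qPochInf_eq_mul_sq (a q : ℂ) (hq : ‖q‖ < 1) :
    qPochInf a q = qPochInf a (q ^ 2) * qPochInf (a * q) (q ^ 2) := by
  have hp := norm_sq_lt_one hq
  have h2 : Tendsto (fun M : ℕ => 2 * M) atTop atTop :=
    tendsto_id.const_mul_atTop' two_pos
  have h := (tendsto_qPoch a q hq).comp h2
  simp only [Function.comp_def, qPoch_two_mul] at h
  exact tendsto_nhds_unique h ((tendsto_qPoch _ _ hp).mul (tendsto_qPoch _ _ hp))

/-- Euler: `(q;q)_∞ (-q²;q²)_∞ (-q;q²)_∞ = (q;q)_∞ (-q;q)_∞ = (q²;q²)_∞`. -/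
theorem qPochInf_denominator (q : ℂ) (hq : ‖q‖ < 1) :
    qPochInf q q * qPochInf (-q ^ 2) (q ^ 2) * qPochInf (-q) (q ^ 2) = qPochInf (q ^ 2) (q ^ 2) := by
  rw [← qPochInf_mul_qPochInf_neg q q hq, qPochInf_eq_mul_sq (-q) q hq,
    show -q * q = -q ^ 2 by ring]
  ring

/-! ### The identity -/

theorem summable_norm_neg_one_zpow_mul_zpow {q : ℂ} (h0 : q ≠ 0) (hq : ‖q‖ < 1) {e : ℤ → ℤ}
    (he : ∀ r, |r| ≤ e r) : Summable fun r : ℤ => ‖(-1) ^ r * q ^ e r‖ := by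
  refine Summable.of_nonneg_of_le (fun _ => norm_nonneg _) (fun r => ?_)
    (summable_pow_natAbs (norm_nonneg q) hq)
  rw [norm_mul, norm_zpow, norm_zpow, norm_neg, norm_one, one_zpow, one_mul]
  exact zpow_le_pow_natAbs (norm_pos_iff.2 h0) hq (he r)

theorem abs_le_ten_mul_sq_add {a : ℤ} (ha : |a| ≤ 9) (r : ℤ) : |r| ≤ 10 * r ^ 2 + a * r := by
  have h1 : |r| ≤ r ^ 2 := by
    rw [← sq_abs]; rcases eq_or_ne r 0 with rfl | h
    · simp
    · nlinarith [Int.one_le_abs h]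
  have h2 : -(9 * |r|) ≤ a * r := by
    have := neg_abs_le (a * r)
    rw [abs_mul] at this
    nlinarith [abs_nonneg r]
  linarith

/-- Inserting the Bailey pair into the `q`-Chu–Vandermonde sum. -/
theorem finite_identity {q : ℂ} (h0 : q ≠ 0) (hq : ‖q‖ < 1) (L : ℕ) :
    ∑' j : ℕ, q ^ (j ^ 2) / qPoch q q (2 * j + 1) * invPoch (q ^ 2) (L - j) =
      qPoch (-q) (q ^ 2) L *
        ∑' r : ℤ, ((-1) ^ r * q ^ (10 * r ^ 2 + 2 * r) + q * ((-1) ^ r * q ^ (10 * r ^ 2 + 6 * r))) *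
          (invPoch (q ^ 2) (L - 2 * r) * invPoch (q ^ 2) (L + 1 + 2 * r)) := by
  have hp := norm_sq_lt_one hq
  have hp0 : q ^ 2 ≠ 0 := pow_ne_zero 2 h0
  have hterm : ∀ j : ℕ, q ^ (j ^ 2) / qPoch q q (2 * j + 1) * invPoch (q ^ 2) (L - j) =
      ∑' r : ℤ, q ^ (j ^ 2) * qPoch (-q) (q ^ 2) (j + 1) * invPoch (q ^ 2) (L - j) *
        ((-1) ^ r * (q ^ 2) ^ (3 * r ^ 2 + r) *
          (invPoch (q ^ 2) (j - 2 * r) * invPoch (q ^ 2) (j + 1 + 2 * r))) := fun j => by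
    have n1 := qPoch_ne_zero q q hq hq (2 * j + 1)
    have n2 := qPoch_ne_zero (q ^ 2) (q ^ 2) hp hp j
    have n3 := qPoch_ne_zero (-q) (q ^ 2) (by rwa [norm_neg]) hp (j + 1)
    have n4 := qPoch_ne_zero q (q ^ 2) hq hp (j + 1)
    have e : qPoch q q (2 * j + 1) = qPoch q (q ^ 2) (j + 1) * qPoch (q ^ 2) (q ^ 2) j := by
      rw [qPoch_succ, qPoch_succ, qPoch_two_mul, ← sq]; ring
    rw [tsum_mul_left, bailey_pair hp0 hp, ← qPoch_mul_qPoch_neg q (q ^ 2), e]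
    field_simp
  rw [tsum_eq_sum (s := Finset.range (L + 1)), Finset.sum_congr rfl fun j _ => hterm j,
    ← Summable.tsum_finsetSum, ← tsum_mul_left]
  · refine tsum_congr fun r => ?_
    have h := congrArg (fun x => (-1) ^ r * (q ^ 2) ^ (3 * r ^ 2 + r) * x)
      (vandermonde_sum h0 hq L (2 * r))
    simp only [Finset.mul_sum] at h
    refine (Finset.sum_congr rfl fun j _ => ?_).trans (h.trans ?_)
    · ring
    · have e1 : q ^ (10 * r ^ 2 + 2 * r) = (q ^ 2) ^ (3 * r ^ 2 + r) * q ^ ((2 * r) ^ 2) := by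
        rw [← zpow_natCast, ← zpow_mul, ← zpow_add₀ h0]; push_cast; ring_nf
      have e2 : q * q ^ (10 * r ^ 2 + 6 * r) =
          (q ^ 2) ^ (3 * r ^ 2 + r) * q ^ ((2 * r + 1) ^ 2) := by
        rw [← zpow_natCast, ← zpow_mul, ← zpow_add₀ h0, ← zpow_one_add₀ h0]; push_cast; ring_nf
      rw [mul_left_comm q, e1, e2]
      ring
  · exact fun j _ => (summable_mul_invPoch (q ^ 2) _ two_pos _ _).mul_left _
  · intro j hj
    rw [Finset.mem_range] at hj
    rw [invPoch_of_neg _ (by omega), mul_zero]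

theorem summable_norm_series {q : ℂ} (hq : ‖q‖ < 1) :
    Summable fun n : ℕ => ‖q ^ (n ^ 2) / qPoch q q (2 * n + 1)‖ := by
  obtain ⟨C, hC⟩ := exists_norm_invPoch_le hq
  refine Summable.of_nonneg_of_le (fun _ => norm_nonneg _) (fun n => ?_)
    ((summable_geometric_of_lt_one (norm_nonneg q) hq).mul_right C)
  rw [div_eq_mul_inv, norm_mul, norm_pow]
  refine mul_le_mul (pow_le_pow_of_le_one (norm_nonneg q) hq.le (Nat.le_self_pow two_ne_zero n))
    (hC ((2 * n + 1 : ℕ) : ℤ)) (norm_nonneg _) (pow_nonneg (norm_nonneg q) n)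

/-- With base `P = q^20`, `z = q^a` and `P / z = q^b`, the triple product has exponents
`20 r(r-1)/2 + a r = 10 r² + (a - 10) r`. -/
theorem tsum_theta {q : ℂ} (h0 : q ≠ 0) (hq : ‖q‖ < 1) {a b : ℕ} (hab : a + b = 20)
    (ha : 1 < a) (hb : 1 < b) {c : ℤ} (hc : c = a - 10) :
    ∑' r : ℤ, (-1) ^ r * q ^ (10 * r ^ 2 + c * r) =
      qPochInf (q ^ a) (q ^ 20) * qPochInf (q ^ b) (q ^ 20) * qPochInf (q ^ 20) (q ^ 20) := by
  have e : q ^ b = q ^ 20 / q ^ a := by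
    rw [eq_div_iff (pow_ne_zero a h0), ← pow_add, add_comm, hab]
  have hP : ‖q ^ 20‖ < 1 := by
    rw [norm_pow]; exact pow_lt_one₀ (norm_nonneg q) hq (by norm_num)
  rw [e]
  refine jacobi_triple_product (pow_ne_zero _ h0) hP (pow_ne_zero _ h0) (by simp) (fun r => ?_)
    (summable_norm_neg_one_zpow_mul_zpow h0 hq
      (abs_le_ten_mul_sq_add (abs_le.2 ⟨by omega, by omega⟩)))
  have e1 : q ^ (10 * (r + 1) ^ 2 + c * (r + 1)) =
      q ^ a * (q ^ 20) ^ r * q ^ (10 * r ^ 2 + c * r) := by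
    rw [← zpow_natCast q a, ← zpow_natCast q 20, ← zpow_mul, ← zpow_add₀ h0, ← zpow_add₀ h0, hc]
    push_cast; ring_nf
  rw [neg_one_zpow_add_one, e1]
  ring

theorem mainTheorem1 (q : ℂ) (hq : ‖q‖ < 1) :
    HasSum (fun n : ℕ => q ^ (n ^ 2) / qPoch q q (2 * n + 1))
      ((qPochInf (q ^ 8) (q ^ 20) * qPochInf (q ^ 12) (q ^ 20) * qPochInf (q ^ 20) (q ^ 20)
          + q * (qPochInf (q ^ 4) (q ^ 20) * qPochInf (q ^ 16) (q ^ 20)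
              * qPochInf (q ^ 20) (q ^ 20)))
        / (qPochInf q q * qPochInf (-q ^ 2) (q ^ 2))) := by
  rcases eq_or_ne q 0 with rfl | h0
  · convert hasSum_single (f := fun n : ℕ => (0 : ℂ) ^ (n ^ 2) / qPoch 0 0 (2 * n + 1)) 0 ?_ using 1
    · simp [qPochInf, qPoch]
    · intro n hn
      simp [hn]
  have hp := norm_sq_lt_one hq
  have hs := summable_norm_series hq
  obtain ⟨C, hC⟩ := exists_norm_invPoch_le hp
  have hl : Tendsto (fun L : ℕ => ∑' j : ℕ,
      q ^ (j ^ 2) / qPoch q q (2 * j + 1) * invPoch (q ^ 2) (L - j)) atTop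
      (𝓝 ((∑' j : ℕ, q ^ (j ^ 2) / qPoch q q (2 * j + 1)) * (qPochInf (q ^ 2) (q ^ 2))⁻¹)) := by
    rw [← tsum_mul_right]
    refine tendsto_tsum_of_dominated_convergence (hs.mul_right C) (fun j => ?_)
      (Eventually.of_forall fun L j => ?_)
    · refine tendsto_const_nhds.mul ((tendsto_invPoch hp).comp ?_)
      simpa [sub_eq_add_neg] using
        tendsto_atTop_add_const_right atTop (-(j : ℤ)) tendsto_natCast_atTop_atTop
    · rw [norm_mul]
      exact mul_le_mul_of_nonneg_left (hC _) (norm_nonneg _)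
  have s1 := summable_norm_neg_one_zpow_mul_zpow h0 hq
    (abs_le_ten_mul_sq_add (a := 2) (by norm_num))
  have s2 := summable_norm_neg_one_zpow_mul_zpow h0 hq
    (abs_le_ten_mul_sq_add (a := 6) (by norm_num))
  have sw : Summable fun r : ℤ => ‖(-1) ^ r * q ^ (10 * r ^ 2 + 2 * r) +
      q * ((-1) ^ r * q ^ (10 * r ^ 2 + 6 * r))‖ :=
    (s1.of_norm.add (s2.of_norm.mul_left q)).norm
  have hr := (tendsto_qPoch (-q) (q ^ 2) hp).mul (tendsto_tsum_mul_invPoch hp sw 2 1)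
  simp only [finite_identity h0 hq] at hl
  have h := tendsto_nhds_unique hl hr
  rw [s1.of_norm.tsum_add (s2.of_norm.mul_left q), tsum_mul_left,
    tsum_theta h0 hq (a := 12) (b := 8) (by norm_num) (by norm_num) (by norm_num) (by norm_num),
    tsum_theta h0 hq (a := 16) (b := 4) (by norm_num) (by norm_num) (by norm_num) (by norm_num)] at h
  have n1 := qPochInf_ne_zero (q ^ 2) (q ^ 2) hp hp
  have n2 := qPochInf_ne_zero q q hq hq
  have n3 := qPochInf_ne_zero (-q ^ 2) (q ^ 2) (by rwa [norm_neg]) hp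
  have n4 := qPochInf_ne_zero (-q) (q ^ 2) (by rwa [norm_neg]) hp
  have hd := qPochInf_denominator q hq
  -- `h` equates the limits of the two sides of `finite_identity`.
  rw [← hd] at h
  refine hs.of_norm.hasSum_iff.2 ?_
  rw [eq_div_iff (mul_ne_zero n2 n3)]
  field_simp at h
  linear_combination h
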